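/- Throughout, $\mathfrak c=2^{\aleph_0}$, and for a locally compact Hausdorff space $Z$ we write $Z^*=\beta Z\setminus Z$ for its Čech–Stone remainder. A homeomorphism $\varphi$ of $Z^*$ is called trivial if there is a continuous $f\colon Z\to Z$ with $\varphi=\beta f\restriction Z^*$, where $\beta f\colon\beta Z\to\beta Z$ is the unique continuous extension of $f$; otherwise it is nontrivial. Assume the Continuum Hypothesis. Let $X$ be a (locally compact) noncompact metrizable topological manifold of dimension $n\ge 1$, that is, a noncompact metrizable space locally homeomorphic to $\mathbb R^n$. (1) $X^*$ has at least $2^{\mathfrak c}$ nontrivial homeomorphisms. If $X$ is moreover second countable (equivalently, Polish), then $X^*$ has exactly $2^{\mathfrak c}$ homeomorphisms, at most $\mathfrak c$ of them are trivial, and exactly $2^{\mathfrak c}$ of them are nontrivial. (2) Let $Y$ be a locally compact Hausdorff space which has a compact connected component. Then $(X\times Y)^*$ has at least $2^{\mathfrak c}$ nontrivial homeomorphisms. If moreover $X$ and $Y$ are second countable, then $(X\times Y)^*$ has exactly $2^{\mathfrak c}$ homeomorphisms, at most $\mathfrak c$ of them are trivial, and exactly $2^{\mathfrak c}$ of them are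 nontrivial. -/

import Mathlib

open scoped Cardinal

/-- The Čech–Stone remainder `X* = βX ∖ X`, with the subspace topology inherited from `βX`. -/
abbrev CechStoneRemainder (X : Type*) [TopologicalSpace X] : Type _ :=
  {p : StoneCech X // p ∉ Set.range (stoneCechUnit : X → StoneCech X)}

/-- A homeomorphism `φ` of `X*` is trivial if there is a continuous `f : X → X` such that `φ` is
the restriction to `X*` of `βf : βX → βX`, the unique continuous extension of `f`. -/
def IsTrivialHomeo {X : Type*} [TopologicalSpace X]
    (φ : CechStoneRemainder X ≃ₜ CechStoneRemainder X) : Prop :=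
  ∃ (f : X → X) (hf : Continuous f), ∀ p : CechStoneRemainder X,
    (φ p : StoneCech X) = stoneCechExtend (continuous_stoneCechUnit.comp hf) (p : StoneCech X)

section

open Filter Topology

/-! A noncompact manifold `X` contains a discrete sequence of balls, each carrying a radial flow
that fixes its boundary. A sequence `h` of rational times moves the `k`-th ball by time `h k`, and
so the group `ℕ → ℚ` acts on the remainder. By uniform continuity on each ball, a given real
function on the remainder is invariant under all `h` tending to zero fast enough, that is, under
`slowSubgroup f` for every sufficiently large `f`. CH gives a scale `F α` of length `ω₁`, cofinal
for everywhere domination. Along it, each binary branch `s` gets times `g s α` that change after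
stage `α` only by elements of `slowSubgroup (F α)`. The motions by `g s α` then converge to a
homeomorphism of the remainder (`exists_limit_homeomorph`), because every real function sees only
one stage. At the first `α` where two branches differ, their times differ by `1 / F α k`, which a
tent function of matching slope detects; this gives `2 ^ 𝔠` homeomorphisms. At most `𝔠` of them are
trivial: the detectors tell them apart using only the radial coordinates of the images of countably
many points, the orbits of the centres at rational times. This needs no countability of the space.
The upper bounds in the second countable case are counts of continuous functions. For `X × Y`, a
compact component of `Y` lies in a compact open set `C`, and balls are replaced by balls times `C`.
-/

/-! ### Coherent families of rational sequences along a scale -/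

/-- The rational sequences `h` with `f * h → 0`. -/
def slowSubgroup (f : ℕ → ℕ) : AddSubgroup (ℕ → ℚ) where
  carrier := {h | Tendsto (fun k => (f k : ℝ) * (h k : ℝ)) atTop (𝓝 0)}
  zero_mem' := by simp
  add_mem' := by
    intro a b ha hb
    have := Tendsto.add ha hb
    simpa [mul_add] using this
  neg_mem' := by
    intro a ha
    have := Tendsto.neg ha
    simpa using this

theorem mem_slowSubgroup {f : ℕ → ℕ} {h : ℕ → ℚ} :
    h ∈ slowSubgroup f ↔ Tendsto (fun k => (f k : ℝ) * (h k : ℝ)) atTop (𝓝 0) := Iff.rfl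

/-- Diagonalisation: `S` eventually dominates each `f j`, and the extra factor `k + 1` makes `f j /
f'` tend to zero. Thus adding `1 / f'` at a new stage is invisible to all earlier ones. -/
theorem exists_dominating {J : Type*} [Countable J] (f : J → ℕ → ℕ) (f₀ : ℕ → ℕ) :
    ∃ f' : ℕ → ℕ, (∀ k, f₀ k ≤ f' k) ∧ (∀ k, 1 ≤ f' k) ∧
      ∀ j, (fun k => (1 / f' k : ℚ)) ∈ slowSubgroup (f j) := by
  classical
  rcases isEmpty_or_nonempty J with hJ | hJ
  · exact ⟨fun k => f₀ k + 1, fun k => by simp, fun k => by simp, fun j => hJ.elim j⟩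
  obtain ⟨b, hb⟩ := exists_surjective_nat J
  set S : ℕ → ℕ := fun k => 1 + f₀ k + ∑ i ∈ Finset.range (k + 1), f (b i) k with hS
  have hS1 : ∀ k, 1 ≤ S k := fun k => by simp only [hS]; omega
  have hSle : ∀ k, S k ≤ (k + 1) * S k := fun k => Nat.le_mul_of_pos_left _ (by omega)
  have hfS : ∀ j, ∀ᶠ k in atTop, f j k ≤ S k := by
    intro j
    obtain ⟨i, rfl⟩ := hb j
    filter_upwards [eventually_ge_atTop i] with k hk
    have : f (b i) k ≤ ∑ i ∈ Finset.range (k + 1), f (b i) k :=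
      Finset.single_le_sum (f := fun i => f (b i) k) (fun _ _ => Nat.zero_le _)
        (Finset.mem_range.2 (by omega))
    simp only [hS]; omega
  refine ⟨fun k => (k + 1) * S k, fun k => le_trans ?_ (hSle k), fun k => (hS1 k).trans (hSle k),
    fun j => ?_⟩
  · simp only [hS]; omega
  · rw [mem_slowSubgroup]
    refine squeeze_zero_norm' ?_ (tendsto_one_div_add_atTop_nhds_zero_nat (𝕜 := ℝ))
    filter_upwards [hfS j] with k hk
    have h1 : (0 : ℝ) < S k := by exact_mod_cast hS1 k
    have h2 : (0 : ℝ) < (k : ℝ) + 1 := by positivity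
    have h3 : (f j k : ℝ) ≤ S k := by exact_mod_cast hk
    push_cast
    rw [Real.norm_of_nonneg (by positivity), mul_one_div, div_le_div_iff₀ (by positivity) h2]
    nlinarith

/-- Passes a limit stage of countable cofinality. The new sequence follows `g (γ n)` along running
maxima `γ n`, switching to the next `n` so late that the first `n` error estimates already hold. -/
theorem exists_coherent_extension {J : Type*} [LinearOrder J] [Countable J] (f : J → ℕ → ℕ)
    (g : J → ℕ → ℚ) (hg : ∀ i j, i < j → g j - g i ∈ slowSubgroup (f i)) :
    ∃ g' : ℕ → ℚ, ∀ i, g' - g i ∈ slowSubgroup (f i) := by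
  classical
  rcases isEmpty_or_nonempty J with hJ | hJ
  · exact ⟨0, fun i => hJ.elim i⟩
  obtain ⟨b, hb⟩ := exists_surjective_nat J
  set γ : ℕ → J := fun n => partialSups b n with hγ
  have hle : ∀ i n, i ≤ n → b i ≤ γ n := fun i n h => le_partialSups_of_le b h
  have hmem : ∀ i n, i ≤ n → g (γ n) - g (b i) ∈ slowSubgroup (f (b i)) := by
    intro i n h
    rcases (hle i n h).eq_or_lt with h | h
    · rw [← h, sub_self]; exact zero_mem _
    · exact hg _ _ h
  have hm : ∀ n, ∃ m, ∀ k, m ≤ k → ∀ i ≤ n,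
      |(f (b i) k : ℝ) * ((g (γ n) k - g (b i) k : ℚ) : ℝ)| ≤ 1 / ((n : ℝ) + 1) := by
    intro n
    have : ∀ᶠ k in atTop, ∀ i ∈ Set.Iic n,
        |(f (b i) k : ℝ) * ((g (γ n) k - g (b i) k : ℚ) : ℝ)| ≤ 1 / ((n : ℝ) + 1) := by
      rw [eventually_all_finite (Set.finite_Iic n)]
      intro i hi
      have h1 := (mem_slowSubgroup.1 (hmem i n hi)).abs
      rw [abs_zero] at h1
      exact (h1.eventually (ge_mem_nhds (by positivity)))
    obtain ⟨m, hm⟩ := eventually_atTop.1 this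
    exact ⟨m, fun k hk i hi => hm k hk i hi⟩
  choose m hm using hm
  -- The largest `n ≤ k` whose estimates are valid from `k` on; it tends to infinity because each `m
  -- n` is finite.
  set N : ℕ → ℕ := fun k => Nat.findGreatest (fun n => m n ≤ k) k with hN
  have hNge : ∀ n k, max n (m n) ≤ k → n ≤ N k := fun n k hk =>
    Nat.le_findGreatest ((le_max_left _ _).trans hk) ((le_max_right _ _).trans hk)
  have hNspec : ∀ k, m 0 ≤ k → m (N k) ≤ k := fun k hk =>
    Nat.findGreatest_spec (P := fun n => m n ≤ k) (Nat.zero_le k) hk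
  have hNtop : Tendsto N atTop atTop := tendsto_atTop.2 fun n =>
    (eventually_ge_atTop (max n (m n))).mono fun k hk => hNge n k hk
  refine ⟨fun k => g (γ (N k)) k, fun j => ?_⟩
  obtain ⟨i, rfl⟩ := hb j
  rw [mem_slowSubgroup]
  refine squeeze_zero_norm' ?_ ((tendsto_one_div_add_atTop_nhds_zero_nat (𝕜 := ℝ)).comp hNtop)
  filter_upwards [hNtop.eventually_ge_atTop i, eventually_ge_atTop (m 0)] with k h1 h2
  exact hm (N k) k (hNspec k h2) i h1

theorem exists_coherent_families (CH : (ℵ₁ : Cardinal.{0}) = 𝔠) :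
    ∃ (ι : Type) (_ : LinearOrder ι) (_ : Nonempty ι) (F : ι → ℕ → ℕ)
      (g : (ι → Bool) → ι → ℕ → ℚ), #ι = 𝔠 ∧
      (∀ f : ℕ → ℕ, ∃ α, ∀ k, f k ≤ F α k) ∧ (∀ α k, 1 ≤ F α k) ∧
      (∀ s α γ, α ≤ γ → g s γ - g s α ∈ slowSubgroup (F α)) ∧
      ∀ s s', s ≠ s' → ∃ α, ∀ k, |g s α k - g s' α k| = 1 / F α k := by
  classical
  let ι : Type := (𝔠 : Cardinal.{0}).ord.ToType
  have hι : #ι = 𝔠 := Cardinal.mk_ord_toType _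
  -- The use of CH: proper initial segments of `𝔠.ord` have size below `𝔠 = ℵ₁`.
  have hcount : ∀ α : ι, Countable (Set.Iio α) := by
    intro α
    rw [← Cardinal.mk_le_aleph0_iff, ← Order.lt_succ_iff, Cardinal.succ_aleph0, CH]
    have := Cardinal.mk_Iio_lt α (by simp [ι])
    simpa [hι] using this
  have hne : Nonempty ι := by
    rw [← Cardinal.mk_ne_zero_iff, hι]; exact Cardinal.continuum_ne_zero
  obtain ⟨e⟩ : Nonempty (ι ≃ (ℕ → ℕ)) := by
    rw [← Cardinal.eq, hι]; simp
  have hwf : WellFounded (fun a b : ι => a < b) := wellFounded_lt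
  have hF : ∃ F : ι → ℕ → ℕ, ∀ α, (∀ k, e α k ≤ F α k) ∧ (∀ k, 1 ≤ F α k) ∧
      ∀ β < α, (fun k => (1 / F α k : ℚ)) ∈ slowSubgroup (F β) := by
    have step := fun (α : ι) (p : (β : ι) → β < α → ℕ → ℕ) =>
      haveI := hcount α
      exists_dominating (fun β : Set.Iio α => p β.1 β.2) (e α)
    choose c hc using step
    refine ⟨hwf.fix c, fun α => ?_⟩
    have := hc α (fun β _ => hwf.fix c β)
    rw [← hwf.fix_eq c α] at this
    exact ⟨this.1, this.2.1, fun β h => this.2.2 ⟨β, h⟩⟩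
  obtain ⟨F, hF⟩ := hF
  -- Coherence of the history is a premise inside the statement, so that `c` is total and can drive
  -- the recursion before coherence is proved.
  have step : ∀ (α : ι) (p : (β : ι) → β < α → ℕ → ℚ), ∃ g' : ℕ → ℚ,
      (∀ β γ (hβ : β < α) (hγ : γ < α), β < γ → p γ hγ - p β hβ ∈ slowSubgroup (F β)) →
      ∀ β (hβ : β < α), g' - p β hβ ∈ slowSubgroup (F β) := by
    intro α p
    by_cases h : ∀ β γ (hβ : β < α) (hγ : γ < α), β < γ → p γ hγ - p β hβ ∈ slowSubgroup (F β)
    · have := hcount α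
      obtain ⟨g', hg'⟩ := exists_coherent_extension (J := Set.Iio α) (fun β => F β)
        (fun β => p β.1 β.2) (fun i j hij => h i j i.2 j.2 hij)
      exact ⟨g', fun _ β hβ => hg' ⟨β, hβ⟩⟩
    · exact ⟨0, fun h' => absurd h' h⟩
  choose c hc using step
  let g : (ι → Bool) → ι → ℕ → ℚ := fun s =>
    hwf.fix fun α p => c α p + if s α then (fun k => (1 / F α k : ℚ)) else 0
  have hg : ∀ s α, g s α = c α (fun β _ => g s β) +
      if s α then (fun k => (1 / F α k : ℚ)) else 0 := fun s α => hwf.fix_eq _ α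
  have hcoh : ∀ s γ, ∀ α < γ, g s γ - g s α ∈ slowSubgroup (F α) := by
    intro s γ
    induction γ using hwf.induction with
    | _ γ ih =>
      intro α hα
      have h1 := hc γ (fun β _ => g s β) (fun β γ' _ hγ' h => ih γ' hγ' β h) α hα
      rw [hg s γ, add_sub_right_comm]
      refine add_mem h1 ?_
      split_ifs
      · exact (hF γ).2.2 α hα
      · exact zero_mem _
  refine ⟨ι, inferInstance, hne, F, g, hι, fun f => ?_, fun α => (hF α).2.1,
    fun s α γ h => ?_, fun s s' hss => ?_⟩
  · obtain ⟨α, rfl⟩ := e.surjective f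
    exact ⟨α, (hF α).1⟩
  · rcases h.eq_or_lt with rfl | h
    · rw [sub_self]; exact zero_mem _
    · exact hcoh s γ α h
  · have hex : {α | s α ≠ s' α}.Nonempty := Function.ne_iff.1 hss
    -- Below the first difference the two recursions agree, so at `α` they share the value of `c α`
    -- and differ by exactly the optional summand `1 / F α`.
    set α := hwf.min _ hex
    have hα : s α ≠ s' α := hwf.min_mem _ hex
    have hlt : ∀ β < α, g s β = g s' β := by
      intro β
      induction β using hwf.induction with
      | _ β ih =>
        intro hβ
        have hs : s β = s' β := by
          by_contra hne
          exact hwf.not_lt_min _ hne hβ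
        have : (fun (δ : ι) (_ : δ < β) => g s δ) = fun δ _ => g s' δ := by
          funext δ hδ
          exact ih δ hδ (hδ.trans hβ)
        rw [hg s, hg s', hs, this]
    refine ⟨α, fun k => ?_⟩
    have : (fun (δ : ι) (_ : δ < α) => g s δ) = fun δ _ => g s' δ := by
      funext δ hδ
      exact hlt δ hδ
    rw [hg s, hg s', this]
    have hpos : (0 : ℚ) ≤ 1 / F α k := by positivity
    cases h1 : s α <;> cases h2 : s' α
    · exact absurd (h1.trans h2.symm) hα
    · simp
    · simp
    · exact absurd (h1.trans h2.symm) hα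

/-! ### Limits of coherent motions on a compact space -/

theorem continuous_of_forall_continuous_real {Z M : Type*} [TopologicalSpace Z] [TopologicalSpace M]
    [CompletelyRegularSpace M] {ψ : Z → M} (h : ∀ A : C(M, ℝ), Continuous (A ∘ ψ)) :
    Continuous ψ := by
  rw [continuous_iff_continuousAt]
  intro p
  rw [ContinuousAt, tendsto_nhds]
  intro U hU hp
  obtain ⟨f, hf, hf0, hf1⟩ := CompletelyRegularSpace.completely_regular_isOpen (ψ p) U hU hp
  have hA := h ⟨fun x => (f x : ℝ), continuous_subtype_val.comp hf⟩
  have : {q | ((f (ψ q) : ℝ)) < 1} ∈ 𝓝 p :=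
    (isOpen_Iio.preimage hA).mem_nhds (by simp [hf0])
  filter_upwards [this] with q hq
  by_contra hqU
  have := hf1 hqU
  simp_all

theorem eq_of_forall_continuous_real {M : Type*} [TopologicalSpace M] [T35Space M] {x y : M}
    (h : ∀ A : C(M, ℝ), A x = A y) : x = y := by
  by_contra hne
  obtain ⟨f, hf, hxy⟩ := separatesPoints_continuous_of_t35Space hne
  exact hxy (h ⟨f, hf⟩)

section Limit

variable {M : Type*} [TopologicalSpace M] [CompactSpace M] [T2Space M]
  {ι : Type*} [LinearOrder ι] [Nonempty ι] {G : Type*} [AddCommGroup G]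

/-- If `A` is `S α`-invariant, the values `A (T (g γ) p)` are constant for `γ ≥ α`, so they pass to
the ultrafilter limit. Continuity of the limit is tested against each `A`, where it agrees with a
single `T (g α)`. -/
theorem exists_limit_map (T : G → M → M) (hTc : ∀ a, Continuous (T a))
    (hTadd : ∀ a b p, T (a + b) p = T a (T b p)) (S : ι → AddSubgroup G)
    (hD : ∀ A : C(M, ℝ), ∃ α, ∀ h ∈ S α, ∀ p, A (T h p) = A p)
    (g : ι → G) (hg : ∀ α γ, α ≤ γ → g γ - g α ∈ S α) :
    ∃ ψ : M → M, Continuous ψ ∧ ∀ α (A : C(M, ℝ)), (∀ h ∈ S α, ∀ p, A (T h p) = A p) →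
      ∀ p, A (ψ p) = A (T (g α) p) := by
  let 𝒰 : Ultrafilter ι := Ultrafilter.of atTop
  have h𝒰 : (𝒰 : Filter ι) ≤ atTop := Ultrafilter.of_le _
  have hlim : ∀ p, ∃ q, Tendsto (fun γ => T (g γ) p) 𝒰 (𝓝 q) := by
    intro p
    obtain ⟨q, -, hq⟩ := isCompact_univ.ultrafilter_le_nhds (𝒰.map fun γ => T (g γ) p) (by simp)
    exact ⟨q, hq⟩
  choose ψ hψ using hlim
  have key : ∀ α (A : C(M, ℝ)), (∀ h ∈ S α, ∀ p, A (T h p) = A p) →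
      ∀ p, A (ψ p) = A (T (g α) p) := by
    intro α A hA p
    have h1 : Tendsto (fun γ => A (T (g γ) p)) 𝒰 (𝓝 (A (ψ p))) :=
      (A.continuous.tendsto _).comp (hψ p)
    refine tendsto_nhds_unique_of_eventuallyEq h1 (tendsto_const_nhds (x := A (T (g α) p))) ?_
    filter_upwards [h𝒰 (eventually_ge_atTop α)] with γ hγ
    rw [← hA _ (hg α γ hγ) (T (g α) p), ← hTadd, sub_add_cancel]
  refine ⟨ψ, continuous_of_forall_continuous_real fun A => ?_, key⟩
  obtain ⟨α, hα⟩ := hD A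
  have : A ∘ ψ = A ∘ T (g α) := funext fun p => key α A hα p
  rw [this]
  exact A.continuous.comp (hTc _)

/-- The inverse is the limit for `-g`. -/
theorem exists_limit_homeomorph (T : G → M → M) (hTc : ∀ a, Continuous (T a))
    (hT0 : ∀ p, T 0 p = p) (hTadd : ∀ a b p, T (a + b) p = T a (T b p)) (S : ι → AddSubgroup G)
    (hD : ∀ A : C(M, ℝ), ∃ α, ∀ h ∈ S α, ∀ p, A (T h p) = A p)
    (g : ι → G) (hg : ∀ α γ, α ≤ γ → g γ - g α ∈ S α) :
    ∃ ψ : M ≃ₜ M, ∀ α (A : C(M, ℝ)), (∀ h ∈ S α, ∀ p, A (T h p) = A p) →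
      ∀ p, A (ψ p) = A (T (g α) p) := by
  have hcancel : ∀ g g' : ι → G, (∀ α, g α + g' α = 0) → ∀ ψ ψ' : M → M,
      (∀ α (A : C(M, ℝ)), (∀ h ∈ S α, ∀ p, A (T h p) = A p) → ∀ p, A (ψ p) = A (T (g α) p)) →
      (∀ α (A : C(M, ℝ)), (∀ h ∈ S α, ∀ p, A (T h p) = A p) → ∀ p, A (ψ' p) = A (T (g' α) p)) →
      ∀ p, ψ (ψ' p) = p := by
    intro g g' hgg ψ ψ' hψ hψ' p
    refine eq_of_forall_continuous_real fun A => ?_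
    obtain ⟨α, hα⟩ := hD A
    rw [hψ α A hα]
    -- Commutativity of `G` makes `A ∘ T (g α)` invariant under `S α` as well.
    have := hψ' α ⟨fun q => A (T (g α) q), A.continuous.comp (hTc _)⟩ (by
      intro h hh q
      change A (T (g α) (T h q)) = A (T (g α) q)
      rw [← hTadd, add_comm, hTadd, hα h hh]) p
    change A (T (g α) (ψ' p)) = A (T (g α) (T (g' α) p)) at this
    rw [this, ← hTadd, hgg, hT0]
  obtain ⟨ψ, hψc, hψ⟩ := exists_limit_map T hTc hTadd S hD g hg
  obtain ⟨ψ', hψc', hψ'⟩ := exists_limit_map T hTc hTadd S hD (fun α => -g α)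
    (fun α γ h => by
      have := neg_mem (hg α γ h)
      rwa [neg_sub, ← neg_sub_neg] at this)
  exact ⟨⟨⟨ψ, ψ', hcancel _ _ (by simp) ψ' ψ hψ' hψ, hcancel _ _ (by simp) ψ ψ' hψ hψ'⟩, hψc, hψc'⟩,
    hψ⟩

end Limit

/-! ### The remainder of a locally compact space -/

section Remainder

variable {W : Type*} [TopologicalSpace W]

theorem comap_stoneCechUnit_le_cocompact (p : CechStoneRemainder W) :
    comap stoneCechUnit (𝓝 (p : StoneCech W)) ≤ cocompact W := by
  intro s hs
  obtain ⟨K, hK, hKs⟩ := mem_cocompact.1 hs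
  have hcl : IsClosed (stoneCechUnit '' K) := (hK.image continuous_stoneCechUnit).isClosed
  refine ⟨(stoneCechUnit '' K)ᶜ, hcl.isOpen_compl.mem_nhds ?_, fun x hx => hKs fun hxK => ?_⟩
  · rintro ⟨x, -, hx⟩
    exact p.2 ⟨x, hx⟩
  · exact hx ⟨x, hxK, rfl⟩

instance comap_stoneCechUnit_neBot (p : StoneCech W) :
    (comap (stoneCechUnit : W → StoneCech W) (𝓝 p)).NeBot :=
  comap_neBot fun _ ht => by
    obtain ⟨_, hx, x, rfl⟩ := mem_closure_iff_nhds.1 (denseRange_stoneCechUnit p) _ ht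
    exact ⟨x, hx⟩

theorem eq_of_tendsto_cocompact {A B : C(StoneCech W, ℝ)}
    (h : Tendsto (fun w => A (stoneCechUnit w) - B (stoneCechUnit w)) (cocompact W) (𝓝 0))
    (p : CechStoneRemainder W) : A p = B p := by
  have h1 := h.mono_left (comap_stoneCechUnit_le_cocompact p)
  have h2 : Tendsto (fun w => A (stoneCechUnit w) - B (stoneCechUnit w))
      (comap stoneCechUnit (𝓝 (p : StoneCech W))) (𝓝 (A p - B p)) :=
    ((A - B).continuous.tendsto (p : StoneCech W)).comp tendsto_comap
  exact sub_eq_zero.1 (tendsto_nhds_unique h2 h1)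

theorem LocallyCompactSpace.t35Space [T2Space W] [LocallyCompactSpace W] : T35Space W :=
  OnePoint.isOpenEmbedding_coe.isEmbedding.t35Space

theorem notMem_range_stoneCechUnit_of_tendsto [T2Space W] [LocallyCompactSpace W] {ι : Type*}
    {l : Filter ι} [l.NeBot] {d : ι → W} (hd : Tendsto d l (cocompact W)) {p : StoneCech W}
    (hp : Tendsto (fun i => stoneCechUnit (d i)) l (𝓝 p)) :
    p ∉ Set.range (stoneCechUnit : W → StoneCech W) := by
  have := LocallyCompactSpace.t35Space (W := W)
  rintro ⟨w, rfl⟩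
  have h1 : Tendsto d l (𝓝 w) := isInducing_stoneCechUnit.tendsto_nhds_iff.2 hp
  obtain ⟨N, hN, hw⟩ := exists_compact_mem_nhds w
  obtain ⟨i, hi, hi'⟩ := (Filter.nonempty_of_mem (inter_mem (h1 hw) (hd hN.compl_mem_cocompact)))
  exact hi' hi

theorem isClosed_cechStoneRemainder [T2Space W] [LocallyCompactSpace W] :
    IsClosed {p : StoneCech W | p ∉ Set.range (stoneCechUnit : W → StoneCech W)} := by
  have := LocallyCompactSpace.t35Space (W := W)
  suffices h : IsOpen (Set.range (stoneCechUnit : W → StoneCech W)) from h.isClosed_compl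
  rw [isOpen_iff_mem_nhds]
  rintro _ ⟨w, rfl⟩
  obtain ⟨N, hN, hwN⟩ := exists_compact_mem_nhds w
  rw [isInducing_stoneCechUnit.nhds_eq_comap] at hwN
  obtain ⟨V, hV, hVN⟩ := hwN
  have hNc : IsClosed (stoneCechUnit '' N) := (hN.image continuous_stoneCechUnit).isClosed
  filter_upwards [interior_mem_nhds.2 hV] with q hq
  have hq' := denseRange_stoneCechUnit.open_subset_closure_inter (isOpen_interior (s := V)) hq
  have hsub : interior V ∩ Set.range stoneCechUnit ⊆ stoneCechUnit '' N := by
    rintro _ ⟨hx, x, rfl⟩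
    have hxV : stoneCechUnit x ∈ V := interior_subset hx
    exact ⟨x, hVN hxV, rfl⟩
  obtain ⟨x, -, hx⟩ := closure_minimal hsub hNc hq'
  exact ⟨x, hx⟩

theorem compactSpace_cechStoneRemainder [T2Space W] [LocallyCompactSpace W] :
    CompactSpace (CechStoneRemainder W) :=
  isCompact_iff_compactSpace.1 (isClosed_cechStoneRemainder (W := W)).isCompact

end Remainder

/-! ### Gluing maps over discrete families -/

section Glue

open Classical in
/-- The function equal to `f k` on `K k` and to `f₀` off all the sets `K k`. -/
noncomputable def glue {W Z : Type*} (K : ℕ → Set W) (f : ℕ → W → Z) (f₀ : W → Z)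
    (x : W) : Z :=
  if h : ∃ k, x ∈ K k then f h.choose x else f₀ x

theorem glue_of_notMem {W Z : Type*} {K : ℕ → Set W} {f : ℕ → W → Z} {f₀ : W → Z}
    {x : W} (hx : ∀ k, x ∉ K k) : glue K f f₀ x = f₀ x :=
  dif_neg fun ⟨k, hk⟩ => hx k hk

variable {W Z : Type*} [TopologicalSpace W]

/-- A family of sets such that each point has a neighbourhood meeting at most one of them. -/
def IsDiscreteFamily (K : ℕ → Set W) : Prop :=
  ∀ x, ∃ k, ∀ᶠ y in 𝓝 x, ∀ j, y ∈ K j → j = k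

variable {K : ℕ → Set W} {f : ℕ → W → Z} {f₀ : W → Z}

theorem IsDiscreteFamily.eq (hK : IsDiscreteFamily K) {x : W} {i j : ℕ} (hi : x ∈ K i)
    (hj : x ∈ K j) : i = j := by
  obtain ⟨k, hk⟩ := hK x
  rw [hk.self_of_nhds i hi, hk.self_of_nhds j hj]

theorem glue_of_mem (hK : IsDiscreteFamily K) {x : W} {k : ℕ} (hx : x ∈ K k) :
    glue K f f₀ x = f k x := by
  have h : ∃ k, x ∈ K k := ⟨k, hx⟩
  rw [glue, dif_pos h, hK.eq h.choose_spec hx]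

theorem continuous_glue [TopologicalSpace Z] (hK : IsDiscreteFamily K) (hf : ∀ k, Continuous (f k))
    (h0 : ∀ k, ∀ x ∉ K k, f k x = f₀ x) : Continuous (glue K f f₀) := by
  rw [continuous_iff_continuousAt]
  intro x
  obtain ⟨k, hk⟩ := hK x
  refine (hf k).continuousAt.congr ?_
  filter_upwards [hk] with y hy
  by_cases h : ∃ j, y ∈ K j
  · obtain ⟨j, hj⟩ := h
    obtain rfl := hy j hj
    exact (glue_of_mem hK hj).symm
  · push Not at h
    rw [glue_of_notMem h, h0 k y (h k)]

/-- A compact set meets only finitely many members of a discrete family. -/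
theorem IsDiscreteFamily.tendsto_cocompact (hK : IsDiscreteFamily K) {d : ℕ → W}
    (hd : ∀ k, d k ∈ K k) : Tendsto d atTop (cocompact W) := by
  intro s hs
  obtain ⟨C, hC, hCs⟩ := mem_cocompact.1 hs
  have : ∃ m, ∀ x ∈ C, ∀ j, x ∈ K j → j < m := by
    refine hC.induction_on (p := fun s => ∃ m, ∀ x ∈ s, ∀ j, x ∈ K j → j < m) ⟨0, by simp⟩
      (fun s t hst ⟨m, hm⟩ => ⟨m, fun x hx => hm x (hst hx)⟩) ?_ ?_
    · rintro s t ⟨m, hm⟩ ⟨m', hm'⟩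
      refine ⟨max m m', fun x hx j hj => ?_⟩
      rcases hx with hx | hx
      · exact (hm x hx j hj).trans_le (le_max_left _ _)
      · exact (hm' x hx j hj).trans_le (le_max_right _ _)
    · intro x _
      obtain ⟨k, hk⟩ := hK x
      refine ⟨_, mem_nhdsWithin_of_mem_nhds hk, k + 1, fun y hy j hj => ?_⟩
      rw [hy j hj]; omega
  obtain ⟨m, hm⟩ := this
  refine mem_map.2 (mem_of_superset (eventually_ge_atTop m) fun k hk => hCs fun hkC => ?_)
  exact absurd (hm _ hkC k (hd k)) (by simpa using hk)

end Glue

/-! ### Estimates for the logistic flow and tent functions -/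

/-- The flow of the logistic equation on `[0, 1]`. -/
noncomputable def logisticFlow (t r : ℝ) : ℝ := Real.exp t * r / (1 - r + Real.exp t * r)

theorem logisticFlow_denom_pos (t : ℝ) {r : ℝ} (hr : r ∈ Set.Icc (0 : ℝ) 1) :
    0 < 1 - r + Real.exp t * r := by
  have := Real.exp_pos t
  obtain ⟨h0, h1⟩ := hr
  rcases h0.eq_or_lt with rfl | h0
  · simp
  · nlinarith [mul_pos this h0]

theorem logisticFlow_one (t : ℝ) : logisticFlow t 1 = 1 := by
  simp [logisticFlow, (Real.exp_pos t).ne']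

theorem logisticFlow_zero_left (r : ℝ) : logisticFlow 0 r = r := by
  simp [logisticFlow]

theorem logisticFlow_half (t : ℝ) : logisticFlow t (1 / 2) = 1 / (1 + Real.exp (-t)) := by
  have := Real.exp_pos t
  rw [logisticFlow, Real.exp_neg]
  field_simp
  ring

theorem logisticFlow_mem {t r : ℝ} (hr : r ∈ Set.Icc (0 : ℝ) 1) :
    logisticFlow t r ∈ Set.Icc (0 : ℝ) 1 := by
  have hD := logisticFlow_denom_pos t hr
  have := Real.exp_pos t
  obtain ⟨h0, h1⟩ := hr
  refine ⟨div_nonneg (by positivity) hD.le, (div_le_one hD).2 (by linarith)⟩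

theorem abs_logisticFlow_sub_le {t r : ℝ} (ht : |t| ≤ 1 / 2) (hr : r ∈ Set.Icc (0 : ℝ) 1) :
    |logisticFlow t r - r| ≤ |t| := by
  have hD := logisticFlow_denom_pos t hr
  have hexp : |Real.exp t - 1| ≤ 2 * |t| := Real.abs_exp_sub_one_le (by linarith)
  have hexp2 : 1 / 2 ≤ Real.exp t := by
    have := Real.add_one_le_exp t
    linarith [(abs_le.1 ht).1]
  obtain ⟨h0, h1⟩ := hr
  have hD2 : 1 / 2 ≤ 1 - r + Real.exp t * r := by nlinarith
  have h : logisticFlow t r - r = r * (1 - r) * (Real.exp t - 1) / (1 - r + Real.exp t * r) := by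
    rw [logisticFlow]; field_simp; ring
  rw [h, abs_div, abs_mul, abs_of_nonneg (mul_nonneg h0 (sub_nonneg.2 h1)), abs_of_pos hD,
    div_le_iff₀ hD]
  have h4 : r * (1 - r) ≤ 1 / 4 := by nlinarith [sq_nonneg (r - 1 / 2)]
  have := abs_nonneg t
  calc r * (1 - r) * |Real.exp t - 1| ≤ 1 / 4 * (2 * |t|) := by gcongr
    _ = |t| * (1 / 2) := by ring
    _ ≤ _ := by gcongr

/-- The constant `8` is the one in the slope of `tent`: time `1 / N` carries `1 / 2` out of the
region where the tent is positive. -/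
theorem abs_logisticFlow_half_sub_ge {t : ℝ} (ht : |t| ≤ 1) :
    |t| / 8 ≤ |logisticFlow t (1 / 2) - 1 / 2| := by
  have key : ∀ t : ℝ, 0 ≤ t → t ≤ 1 → t / 8 ≤ 1 / (1 + Real.exp (-t)) - 1 / 2 := by
    intro t h0 h1
    have h2 : Real.exp (-t) ≤ 1 / (1 + t) := by
      rw [Real.exp_neg, ← one_div]
      exact one_div_le_one_div_of_le (by linarith) (by linarith [Real.add_one_le_exp t])
    have h3 : Real.exp (-t) ≤ 1 - t / 2 := by
      refine h2.trans ?_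
      rw [div_le_iff₀ (by linarith)]
      nlinarith
    have h4 := Real.exp_pos (-t)
    rw [div_sub_div _ _ (by positivity) (by norm_num), div_le_div_iff₀ (by norm_num) (by positivity)]
    nlinarith
  rw [logisticFlow_half]
  rcases le_total 0 t with h | h
  · rw [abs_of_nonneg h] at ht ⊢
    exact (key t h ht).trans (le_abs_self _)
  · rw [abs_of_nonpos h] at ht ⊢
    refine (key (-t) (by linarith) ht).trans ?_
    rw [neg_neg]
    refine le_trans (le_of_eq ?_) (neg_le_abs _)
    have := Real.exp_pos t
    rw [Real.exp_neg]
    field_simp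
    ring

/-- The tent function of height `1` and slope `8 * N` centred at `1 / 2`. -/
noncomputable def tent (N : ℕ) (r : ℝ) : ℝ := max 0 (1 - 8 * N * |r - 1 / 2|)

theorem continuous_tent (N : ℕ) : Continuous (tent N) := by
  unfold tent; fun_prop

theorem tent_mem (N : ℕ) (r : ℝ) : tent N r ∈ Set.Icc (0 : ℝ) 1 :=
  ⟨le_max_left _ _, max_le zero_le_one (by
    have : 0 ≤ 8 * N * |r - 1 / 2| := by positivity
    linarith)⟩

theorem tent_one {N : ℕ} (hN : 1 ≤ N) : tent N 1 = 0 := by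
  have : (1 : ℝ) ≤ N := by exact_mod_cast hN
  refine max_eq_left ?_
  norm_num
  linarith

theorem tent_half (N : ℕ) : tent N (1 / 2) = 1 := by simp [tent]

theorem abs_tent_sub_le (N : ℕ) (r r' : ℝ) : |tent N r - tent N r'| ≤ 8 * N * |r - r'| := by
  refine (abs_max_sub_max_le_max _ _ _ _).trans ?_
  rw [sub_self, abs_zero, max_eq_right (abs_nonneg _)]
  have : (1 - 8 * N * |r - 1 / 2|) - (1 - 8 * N * |r' - 1 / 2|) =
    8 * N * (|r' - 1 / 2| - |r - 1 / 2|) := by ring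
  rw [this, abs_mul, abs_of_nonneg (by positivity : (0 : ℝ) ≤ 8 * N)]
  refine mul_le_mul_of_nonneg_left ((abs_abs_sub_abs_le _ _).trans (le_of_eq ?_)) (by positivity)
  rw [abs_sub_comm]; congr 1; ring

theorem tent_logisticFlow_half {N : ℕ} (hN : 1 ≤ N) {t : ℝ} (ht : |t| = 1 / N) :
    tent N (logisticFlow t (1 / 2)) = 0 := by
  have hN' : (1 : ℝ) ≤ N := by exact_mod_cast hN
  have h1 : |t| ≤ 1 := by rw [ht, div_le_one (by linarith)]; exact hN'
  have h2 := abs_logisticFlow_half_sub_ge h1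
  refine max_eq_left ?_
  have : 8 * N * (|t| / 8) = 1 := by rw [ht]; field_simp
  have h3 : 8 * N * (|t| / 8) ≤ 8 * N * |logisticFlow t (1 / 2) - 1 / 2| := by gcongr
  linarith

/-! ### Bump flows and their action on the remainder -/

/-- A discrete sequence of compact sets `K k`, each carrying a flow `F k` supported in `K k` and
semiconjugate to the logistic flow through a function `r k`. -/
structure BumpFlow (W : Type*) [TopologicalSpace W] where
  K : ℕ → Set W
  isCompact_K : ∀ k, IsCompact (K k)
  discrete : IsDiscreteFamily K
  F : ℕ → ℝ → W → W
  continuous_F : ∀ k, Continuous fun p : ℝ × W => F k p.1 p.2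
  F_zero : ∀ k x, F k 0 x = x
  F_add : ∀ k s t x, F k (s + t) x = F k s (F k t x)
  F_of_notMem : ∀ k t, ∀ x ∉ K k, F k t x = x
  r : ℕ → W → ℝ
  continuous_r : ∀ k, Continuous (r k)
  r_mem : ∀ k x, r k x ∈ Set.Icc (0 : ℝ) 1
  r_of_notMem : ∀ k, ∀ x ∉ K k, r k x = 1
  r_F : ∀ k t x, r k (F k t x) = logisticFlow t (r k x)
  center : ℕ → W
  center_mem : ∀ k, center k ∈ K k
  r_center : ∀ k, r k (center k) = 1 / 2

namespace BumpFlow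

variable {W : Type*} [TopologicalSpace W] (B : BumpFlow W)

theorem F_mem {k : ℕ} (t : ℝ) {x : W} (hx : x ∈ B.K k) : B.F k t x ∈ B.K k := by
  by_contra h
  have h1 := B.F_of_notMem k (-t) _ h
  rw [← B.F_add, neg_add_cancel, B.F_zero] at h1
  rw [← h1] at h
  exact h hx

/-- Flow for time `h k` on each set `K k`. -/
noncomputable def move (h : ℕ → ℚ) : W → W := glue B.K (fun k => B.F k (h k)) id

theorem move_of_mem (h : ℕ → ℚ) {k : ℕ} {x : W} (hx : x ∈ B.K k) : B.move h x = B.F k (h k) x :=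
  glue_of_mem B.discrete hx

theorem move_of_notMem (h : ℕ → ℚ) {x : W} (hx : ∀ k, x ∉ B.K k) : B.move h x = x :=
  glue_of_notMem hx

theorem continuous_move (h : ℕ → ℚ) : Continuous (B.move h) :=
  continuous_glue B.discrete
    (fun k => (B.continuous_F k).comp (continuous_const.prodMk continuous_id))
    fun k x hx => B.F_of_notMem k _ x hx

theorem move_zero (x : W) : B.move 0 x = x := by
  by_cases hx : ∃ k, x ∈ B.K k
  · obtain ⟨k, hk⟩ := hx
    rw [B.move_of_mem _ hk, Pi.zero_apply, Rat.cast_zero, B.F_zero]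
  · push Not at hx
    exact B.move_of_notMem _ hx

theorem move_add (a b : ℕ → ℚ) (x : W) : B.move (a + b) x = B.move a (B.move b x) := by
  by_cases hx : ∃ k, x ∈ B.K k
  · obtain ⟨k, hk⟩ := hx
    rw [B.move_of_mem b hk, B.move_of_mem a (B.F_mem _ hk), B.move_of_mem _ hk, Pi.add_apply,
      Rat.cast_add, B.F_add]
  · push Not at hx
    simp only [B.move_of_notMem _ hx]

/-- The extension of `B.move h` to the Čech–Stone compactification. -/
noncomputable def betaMove (h : ℕ → ℚ) : StoneCech W → StoneCech W :=
  stoneCechExtend (continuous_stoneCechUnit.comp (B.continuous_move h))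

theorem continuous_betaMove (h : ℕ → ℚ) : Continuous (B.betaMove h) :=
  continuous_stoneCechExtend _

theorem betaMove_unit (h : ℕ → ℚ) (x : W) :
    B.betaMove h (stoneCechUnit x) = stoneCechUnit (B.move h x) :=
  stoneCechExtend_stoneCechUnit _ x

theorem betaMove_zero (p : StoneCech W) : B.betaMove 0 p = p := by
  refine congrFun (stoneCech_hom_ext (B.continuous_betaMove 0) continuous_id ?_) p
  funext x
  simp [betaMove_unit, move_zero]

theorem betaMove_add (a b : ℕ → ℚ) (p : StoneCech W) :
    B.betaMove (a + b) p = B.betaMove a (B.betaMove b p) := by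
  refine congrFun (stoneCech_hom_ext (B.continuous_betaMove _)
    ((B.continuous_betaMove a).comp (B.continuous_betaMove b)) ?_) p
  funext x
  simp [betaMove_unit, move_add]

/-- The action of `B.move h` on the remainder. -/
noncomputable def remainderMove (h : ℕ → ℚ) (p : CechStoneRemainder W) : CechStoneRemainder W :=
  ⟨B.betaMove h p, by
    rintro ⟨w, hw⟩
    refine p.2 ⟨B.move (-h) w, ?_⟩
    rw [← betaMove_unit, hw, ← betaMove_add, neg_add_cancel, betaMove_zero]⟩

theorem betaMove_eq_of_tendsto {A : C(StoneCech W, ℝ)} {h : ℕ → ℚ} {e : ℕ → ℝ}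
    (he : Tendsto e atTop (𝓝 0))
    (hA : ∀ᶠ k in atTop, ∀ w ∈ B.K k,
      |A (stoneCechUnit (B.F k (h k) w)) - A (stoneCechUnit w)| ≤ e k)
    (p : CechStoneRemainder W) : A (B.betaMove h p) = A p := by
  refine eq_of_tendsto_cocompact (A := A.comp ⟨_, B.continuous_betaMove h⟩) (B := A) ?_ p
  rw [Metric.tendsto_nhds]
  intro ε hε
  obtain ⟨m, hm⟩ := eventually_atTop.1 (hA.and (he.eventually (gt_mem_nhds hε)))
  have hC : IsCompact (⋃ k ∈ Finset.range m, B.K k) :=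
    (Finset.range m).isCompact_biUnion fun k _ => B.isCompact_K k
  filter_upwards [hC.compl_mem_cocompact] with w hw
  simp only [ContinuousMap.comp_apply, ContinuousMap.coe_mk, betaMove_unit, dist_zero_right,
    Real.norm_eq_abs]
  by_cases hx : ∃ k, w ∈ B.K k
  · obtain ⟨k, hk⟩ := hx
    have hmk : m ≤ k := by
      by_contra hlt
      exact hw (Set.mem_biUnion (x := k) (by simpa using hlt) hk)
    rw [B.move_of_mem _ hk]
    exact ((hm k hmk).1 w hk).trans_lt (hm k hmk).2
  · push Not at hx
    simpa [B.move_of_notMem _ hx] using hε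

theorem exists_nat_forall_abs_sub_le (A : C(StoneCech W, ℝ)) (k : ℕ) {ε : ℝ} (hε : 0 < ε) :
    ∃ N : ℕ, ∀ t : ℝ, |N * t| ≤ 1 → ∀ w ∈ B.K k,
      |A (stoneCechUnit (B.F k t w)) - A (stoneCechUnit w)| ≤ ε := by
  have hc : Continuous fun z : ℝ × W =>
      |A (stoneCechUnit (B.F k z.1 z.2)) - A (stoneCechUnit z.2)| := by
    have h1 := A.continuous.comp (continuous_stoneCechUnit.comp (B.continuous_F k))
    have h2 := A.continuous.comp (continuous_stoneCechUnit.comp (continuous_snd (X := ℝ) (Y := W)))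
    exact (h1.sub h2).abs
  have := (B.isCompact_K k).eventually_forall_of_forall_eventually (x₀ := (0 : ℝ))
    (P := fun t w => |A (stoneCechUnit (B.F k t w)) - A (stoneCechUnit w)| ≤ ε) (fun w _ => by
      refine (hc.tendsto (0, w)).eventually (ge_mem_nhds ?_)
      simpa [B.F_zero] using hε)
  obtain ⟨δ, hδ, hball⟩ := Metric.eventually_nhds_iff.1 this
  obtain ⟨N, hN⟩ := exists_nat_gt (1 / δ)
  refine ⟨N, fun t ht w hw => hball ?_ w hw⟩
  rw [dist_zero_right, Real.norm_eq_abs]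
  have hNpos : (0 : ℝ) < N := lt_trans (by positivity) hN
  rw [abs_mul, Nat.abs_cast, ← le_div_iff₀' hNpos] at ht
  refine ht.trans_lt ?_
  rwa [div_lt_comm₀ hNpos hδ]

/-- On the compact set `K k`, flowing for time at most `1 / f k` changes `A` by at most `1 / (k +
1)`. For slow `h` the change thus vanishes at infinity, hence on the remainder. -/
theorem exists_forall_betaMove_eq (A : C(StoneCech W, ℝ)) :
    ∃ f : ℕ → ℕ, ∀ f' : ℕ → ℕ, (∀ k, f k ≤ f' k) → ∀ h ∈ slowSubgroup f',
      ∀ p : CechStoneRemainder W, A (B.betaMove h p) = A p := by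
  choose f hf using fun k => B.exists_nat_forall_abs_sub_le A k
    (ε := 1 / ((k : ℝ) + 1)) (by positivity)
  refine ⟨f, fun f' hff h hh p => B.betaMove_eq_of_tendsto
    (tendsto_one_div_add_atTop_nhds_zero_nat (𝕜 := ℝ)) ?_ p⟩
  have h1 := (mem_slowSubgroup.1 hh).abs
  rw [abs_zero] at h1
  filter_upwards [h1.eventually (ge_mem_nhds one_pos)] with k hk
  refine hf k _ (le_trans ?_ hk)
  rw [abs_mul, abs_mul, Nat.abs_cast, Nat.abs_cast]
  gcongr
  exact hff k

/-- The function equal to the tent of slope `8 * f k` in the coordinate `r k` on each `K k`. -/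
noncomputable def detector (f : ℕ → ℕ) : W → ℝ := glue B.K (fun k x => tent (f k) (B.r k x)) 0

theorem detector_of_mem (f : ℕ → ℕ) {k : ℕ} {x : W} (hx : x ∈ B.K k) :
    B.detector f x = tent (f k) (B.r k x) := glue_of_mem B.discrete hx

theorem detector_mem (f : ℕ → ℕ) (x : W) : B.detector f x ∈ Set.Icc (0 : ℝ) 1 := by
  by_cases hx : ∃ k, x ∈ B.K k
  · obtain ⟨k, hk⟩ := hx
    rw [B.detector_of_mem f hk]
    exact tent_mem _ _
  · push Not at hx
    rw [detector, glue_of_notMem hx]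
    simp

variable {f : ℕ → ℕ}

theorem continuous_detector (hf : ∀ k, 1 ≤ f k) : Continuous (B.detector f) :=
  continuous_glue B.discrete (fun k => (continuous_tent _).comp (B.continuous_r k))
    fun k x hx => by rw [B.r_of_notMem k x hx, tent_one (hf k), Pi.zero_apply]

/-- Off `K k` the coordinate `r k` is `1`, where the tent vanishes, so membership in the sets `K k`
need not be known. This is what makes countable data suffice for trivial maps. -/
theorem detector_congr (hf : ∀ k, 1 ≤ f k) {x y : W} (h : ∀ k, B.r k x = B.r k y) :
    B.detector f x = B.detector f y := by
  have key : ∀ {x y : W}, (∀ k, B.r k x = B.r k y) → (∀ k, x ∉ B.K k) →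
      B.detector f x = B.detector f y := by
    intro x y h hx
    by_cases hy : ∃ k, y ∈ B.K k
    · obtain ⟨k, hk⟩ := hy
      rw [B.detector_of_mem f hk, ← h k, B.r_of_notMem k x (hx k), tent_one (hf k), detector,
        glue_of_notMem hx, Pi.zero_apply]
    · push Not at hy
      rw [detector, glue_of_notMem hx, glue_of_notMem hy, Pi.zero_apply, Pi.zero_apply]
  by_cases hx : ∃ k, x ∈ B.K k
  · obtain ⟨k, hk⟩ := hx
    by_cases hy : y ∈ B.K k
    · rw [B.detector_of_mem f hk, B.detector_of_mem f hy, h k]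
    · rw [B.detector_of_mem f hk, h k, B.r_of_notMem k y hy, tent_one (hf k)]
      by_cases hy : ∃ j, y ∈ B.K j
      · obtain ⟨j, hj⟩ := hy
        have hxj : x ∉ B.K j := fun hxj => by
          obtain rfl := B.discrete.eq hk hxj
          contradiction
        rw [B.detector_of_mem f hj, ← h j, B.r_of_notMem j x hxj, tent_one (hf j)]
      · push Not at hy
        rw [detector, glue_of_notMem hy, Pi.zero_apply]
  · push Not at hx
    exact key h hx

theorem exists_extension_detector (hf : ∀ k, 1 ≤ f k) :
    ∃ A : C(StoneCech W, ℝ), ∀ w, A (stoneCechUnit w) = B.detector f w := by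
  have hc : Continuous fun w => (⟨B.detector f w, B.detector_mem f w⟩ : Set.Icc (0 : ℝ) 1) :=
    (B.continuous_detector hf).subtype_mk _
  exact ⟨⟨fun p => ((stoneCechExtend hc p : Set.Icc (0 : ℝ) 1) : ℝ),
    continuous_subtype_val.comp (continuous_stoneCechExtend hc)⟩, fun w => by simp⟩

theorem betaMove_detector_eq (hf : ∀ k, 1 ≤ f k) {A : C(StoneCech W, ℝ)}
    (hA : ∀ w, A (stoneCechUnit w) = B.detector f w) {h : ℕ → ℚ} (hh : h ∈ slowSubgroup f)
    (p : CechStoneRemainder W) : A (B.betaMove h p) = A p := by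
  have h1 := (mem_slowSubgroup.1 hh).abs
  rw [abs_zero] at h1
  refine B.betaMove_eq_of_tendsto (e := fun k => 8 * |(f k : ℝ) * (h k : ℝ)|)
    (by simpa using h1.const_mul 8) ?_ p
  filter_upwards [h1.eventually (ge_mem_nhds (by norm_num : (0 : ℝ) < 1 / 2))] with k hk w hw
  rw [hA, hA, B.detector_of_mem f hw, B.detector_of_mem f (B.F_mem _ hw), B.r_F]
  have hfk : (1 : ℝ) ≤ f k := by exact_mod_cast hf k
  have h2 : |(h k : ℝ)| ≤ 1 / 2 := by
    refine le_trans ?_ hk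
    rw [abs_mul, Nat.abs_cast]
    nlinarith [abs_nonneg (h k : ℝ)]
  refine (abs_tent_sub_le _ _ _).trans ?_
  rw [abs_mul, Nat.abs_cast, ← mul_assoc]
  exact mul_le_mul_of_nonneg_left (abs_logisticFlow_sub_le h2 (B.r_mem k w)) (by positivity)

end BumpFlow

/-! ### Many nontrivial homeomorphisms -/

namespace BumpFlow

variable {W : Type*} [TopologicalSpace W] (B : BumpFlow W)

/-- The point of the orbit of the `k`-th centre at time `q`. -/
noncomputable def orbitPoint (z : ℕ × ℚ) : W := B.F z.1 z.2 (B.center z.1)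

theorem orbitPoint_mem (z : ℕ × ℚ) : B.orbitPoint z ∈ B.K z.1 := B.F_mem _ (B.center_mem _)

theorem betaMove_detector_limit {f : ℕ → ℕ} {A : C(StoneCech W, ℝ)}
    (hA : ∀ w, A (stoneCechUnit w) = B.detector f w) {q : ℕ → ℚ} {p : StoneCech W}
    (hp : Tendsto (fun k => stoneCechUnit (B.orbitPoint (k, q k))) (hyperfilter ℕ) (𝓝 p))
    {h : ℕ → ℚ} {c : ℝ} (hc : ∀ k, tent (f k) (logisticFlow (h k + q k : ℚ) (1 / 2)) = c) :
    A (B.betaMove h p) = c := by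
  have h1 := ((A.continuous.comp (B.continuous_betaMove h)).tendsto p).comp hp
  refine tendsto_nhds_unique h1 (tendsto_const_nhds.congr fun k => ?_)
  simp only [Function.comp_apply]
  rw [betaMove_unit, hA, B.move_of_mem _ (B.orbitPoint_mem _),
    B.detector_of_mem f (B.F_mem _ (B.orbitPoint_mem _)), orbitPoint, ← B.F_add, B.r_F, B.r_center,
    ← Rat.cast_add, hc]

theorem trivial_detector_limit {f : ℕ → ℕ} {A : C(StoneCech W, ℝ)}
    (hA : ∀ w, A (stoneCechUnit w) = B.detector f w) {q : ℕ → ℚ} {p : StoneCech W}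
    (hp : Tendsto (fun k => stoneCechUnit (B.orbitPoint (k, q k))) (hyperfilter ℕ) (𝓝 p))
    {u : W → W} (hu : Continuous u) :
    Tendsto (fun k => B.detector f (u (B.orbitPoint (k, q k)))) (hyperfilter ℕ)
      (𝓝 (A (stoneCechExtend (continuous_stoneCechUnit.comp hu) p))) := by
  have h1 := ((A.continuous.comp
    (continuous_stoneCechExtend (continuous_stoneCechUnit.comp hu))).tendsto p).comp hp
  refine h1.congr fun k => ?_
  simp [hA]

variable [T2Space W] [LocallyCompactSpace W]

theorem exists_limit_orbitPoint (q : ℕ → ℚ) :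
    ∃ p : CechStoneRemainder W, Tendsto (fun k => stoneCechUnit (B.orbitPoint (k, q k)))
      (hyperfilter ℕ) (𝓝 (p : StoneCech W)) := by
  obtain ⟨p, -, hp⟩ := isCompact_univ.ultrafilter_le_nhds
    ((hyperfilter ℕ).map fun k => (stoneCechUnit (B.orbitPoint (k, q k)) : StoneCech W)) (by simp)
  refine ⟨⟨p, notMem_range_stoneCechUnit_of_tendsto (l := (hyperfilter ℕ : Filter ℕ)) ?_ hp⟩, hp⟩
  exact (B.discrete.tendsto_cocompact fun k => B.orbitPoint_mem (k, q k)).mono_left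
    Nat.hyperfilter_le_atTop

theorem exists_limit_homeomorph {ι : Type} [LinearOrder ι] [Nonempty ι] (F : ι → ℕ → ℕ)
    (hF : ∀ f : ℕ → ℕ, ∃ α, ∀ k, f k ≤ F α k) (g : ι → ℕ → ℚ)
    (hg : ∀ α γ, α ≤ γ → g γ - g α ∈ slowSubgroup (F α)) :
    ∃ ψ : CechStoneRemainder W ≃ₜ CechStoneRemainder W, ∀ α (A : C(StoneCech W, ℝ)),
      (∀ h ∈ slowSubgroup (F α), ∀ p : CechStoneRemainder W, A (B.betaMove h p) = A p) →
      ∀ p, A (ψ p) = A (B.betaMove (g α) p) := by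
  have hcl := isClosed_cechStoneRemainder (W := W)
  have := compactSpace_cechStoneRemainder (W := W)
  obtain ⟨ψ, hψ⟩ := _root_.exists_limit_homeomorph (M := CechStoneRemainder W) B.remainderMove
    (fun a => ((B.continuous_betaMove a).comp continuous_subtype_val).subtype_mk _)
    (fun p => Subtype.ext (B.betaMove_zero p)) (fun a b p => Subtype.ext (B.betaMove_add a b p))
    (fun α => slowSubgroup (F α)) (fun A => by
      obtain ⟨A', hA'⟩ := ContinuousMap.exists_restrict_eq hcl A
      obtain ⟨f, hf⟩ := B.exists_forall_betaMove_eq A'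
      obtain ⟨α, hα⟩ := hF f
      refine ⟨α, fun h hh p => ?_⟩
      rw [← hA']
      exact hf _ hα h hh p) g hg
  exact ⟨ψ, fun α A hA p => hψ α ⟨fun q => A q, A.continuous.comp continuous_subtype_val⟩ hA p⟩

theorem continuum_power_le_nontrivial (B : BumpFlow W) (CH : (ℵ₁ : Cardinal.{0}) = 𝔠) :
    2 ^ 𝔠 ≤ #{φ : CechStoneRemainder W ≃ₜ CechStoneRemainder W // ¬ IsTrivialHomeo φ} := by
  classical
  obtain ⟨ι, _, _, F, g, hι, hF, hF1, hg, hsep⟩ := exists_coherent_families CH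
  choose ψ hψ using fun s => B.exists_limit_homeomorph F hF (g s) (hg s)
  have key : ∀ s s', s ≠ s' → ∃ (f : ℕ → ℕ) (A : C(StoneCech W, ℝ)) (q : ℕ → ℚ)
      (p : CechStoneRemainder W), (∀ k, 1 ≤ f k) ∧ (∀ w, A (stoneCechUnit w) = B.detector f w) ∧
      Tendsto (fun k => stoneCechUnit (B.orbitPoint (k, q k))) (hyperfilter ℕ)
        (𝓝 (p : StoneCech W)) ∧ A (ψ s p) = 1 ∧ A (ψ s' p) = 0 := by
    intro s s' hss
    obtain ⟨α, hα⟩ := hsep s s' hss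
    obtain ⟨A, hA⟩ := B.exists_extension_detector (hF1 α)
    -- Starting at time `-g s α k`, the branch `s` returns to the centre, at the tip of the tent,
    -- while `s'` ends at time `±1 / F α k`, where the tent is zero.
    obtain ⟨p, hp⟩ := B.exists_limit_orbitPoint fun k => -g s α k
    have hinv := fun h (hh : h ∈ slowSubgroup (F α)) p => B.betaMove_detector_eq (hF1 α) hA hh p
    refine ⟨F α, A, _, p, hF1 α, hA, hp, ?_, ?_⟩
    · rw [hψ s α A hinv p]
      refine B.betaMove_detector_limit hA hp fun k => ?_
      rw [add_neg_cancel, Rat.cast_zero, logisticFlow_zero_left, tent_half]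
    · rw [hψ s' α A hinv p]
      refine B.betaMove_detector_limit hA hp fun k => tent_logisticFlow_half (hF1 α k) ?_
      have := hα k
      rw [abs_sub_comm, sub_eq_add_neg] at this
      rw [← Rat.cast_abs, this]
      simp
  have hinj : Function.Injective ψ := by
    intro s s' h
    by_contra hne
    obtain ⟨f, A, q, p, -, -, -, h1, h0⟩ := key s s' hne
    rw [h, h0] at h1
    exact zero_ne_one h1
  set T : Set (ι → Bool) := {s | IsTrivialHomeo (ψ s)} with hT
  have hTle : #T ≤ 𝔠 := by
    choose u hu hψu using fun s : T => s.2
    -- Equal data would give equal detector values along the orbit points, whose limits are `1` and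
    -- `0`. Rational times keep the index set countable.
    let D : T → (ℕ × ℚ → ℕ → ℝ) := fun s z j => B.r j (u s (B.orbitPoint z))
    have hD : Function.Injective D := by
      intro s s' h
      by_contra hne
      obtain ⟨f, A, q, p, hf, hA, hp, h1, h0⟩ := key s s' (fun h => hne (Subtype.ext h))
      rw [hψu] at h1 h0
      have t1 := B.trivial_detector_limit hA hp (hu s)
      have t0 := B.trivial_detector_limit hA hp (hu s')
      rw [h1] at t1
      rw [h0] at t0
      refine zero_ne_one (tendsto_nhds_unique (t0.congr fun k => ?_) t1)
      exact B.detector_congr hf fun j => (congrFun (congrFun h (k, q k)) j).symm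
    refine (Cardinal.mk_le_of_injective hD).trans (le_of_eq ?_)
    simp [Cardinal.mk_real]
  have hS : #(ι → Bool) = 2 ^ 𝔠 := by simp [hι]
  have hinf : Infinite (ι → Bool) := by
    rw [Cardinal.infinite_iff, hS]
    exact Cardinal.aleph0_le_continuum.trans (Cardinal.cantor _).le
  have hTc : #(Tᶜ : Set (ι → Bool)) = 2 ^ 𝔠 := by
    rw [Cardinal.mk_compl_of_infinite _ (by rw [hS]; exact hTle.trans_lt (Cardinal.cantor _)), hS]
  have := Cardinal.lift_mk_le_lift_mk_of_injective
    (f := fun s : (Tᶜ : Set (ι → Bool)) => (⟨ψ s, s.2⟩ :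
      {φ : CechStoneRemainder W ≃ₜ CechStoneRemainder W // ¬ IsTrivialHomeo φ}))
    (fun s s' h => Subtype.ext (hinj (congrArg Subtype.val h)))
  rw [hTc] at this
  simpa using this

end BumpFlow

/-! ### Upper bounds on cardinalities -/

section Counting

theorem mk_le_continuum_of_injective {α : Type*} {β : Type} (hβ : #β ≤ 𝔠) {f : α → β}
    (hf : Function.Injective f) : #α ≤ 𝔠 := by
  have h := Cardinal.lift_mk_le_lift_mk_of_injective hf
  have h2 := Cardinal.lift_le.2 hβ
  simpa using h.trans h2

theorem mk_le_continuum_of_secondCountable (W : Type*) [TopologicalSpace W] [T0Space W]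
    [SecondCountableTopology W] : #W ≤ 𝔠 := by
  have hb := TopologicalSpace.isBasis_countableBasis W
  let j : W → Set (TopologicalSpace.countableBasis W) := fun x => {s | x ∈ s.1}
  have hj : Function.Injective j := by
    intro x y h
    refine (hb.inseparable_iff.2 fun s hs => ?_).eq
    exact Set.ext_iff.1 h ⟨s, hs⟩
  refine (Cardinal.mk_le_of_injective hj).trans ?_
  rw [Cardinal.mk_set, ← Cardinal.two_power_aleph0]
  exact Cardinal.power_le_power_left two_ne_zero
    (Cardinal.mk_le_aleph0_iff.2 (TopologicalSpace.countable_countableBasis W))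

theorem mk_continuousMap_le_continuum {W Z : Type*} [TopologicalSpace W]
    [TopologicalSpace.SeparableSpace W] [TopologicalSpace Z] [T2Space Z] (hZ : #Z ≤ 𝔠) :
    #C(W, Z) ≤ 𝔠 := by
  obtain ⟨j⟩ : Nonempty (Z ↪ (ℕ → Bool)) := by
    rw [← Cardinal.lift_mk_le']
    simpa using hZ
  rcases isEmpty_or_nonempty W with hW | hW
  · exact mk_le_continuum_of_injective (β := PUnit) (by simpa using Cardinal.nat_lt_continuum 1 |>.le)
      (f := fun _ => PUnit.unit) (fun f g _ => ContinuousMap.ext fun x => hW.elim x)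
  · refine mk_le_continuum_of_injective (β := ℕ → ℕ → Bool) (by simp)
      (f := fun f n => j (f (TopologicalSpace.denseSeq W n))) fun f g h => ?_
    refine DFunLike.coe_injective ((TopologicalSpace.denseRange_denseSeq W).equalizer
      f.continuous g.continuous (funext fun n => j.injective (congrFun h n)))

variable {W : Type*} [TopologicalSpace W]

theorem mk_trivialHomeo_le [T2Space W] [SecondCountableTopology W] :
    #{φ : CechStoneRemainder W ≃ₜ CechStoneRemainder W // IsTrivialHomeo φ} ≤ 𝔠 := by
  choose f hf hφ using fun φ : {φ : CechStoneRemainder W ≃ₜ CechStoneRemainder W //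
    IsTrivialHomeo φ} => φ.2
  refine (Cardinal.mk_le_of_injective (f := fun φ => (⟨f φ, hf φ⟩ : C(W, W))) ?_).trans
    (mk_continuousMap_le_continuum (mk_le_continuum_of_secondCountable W))
  intro φ φ' h
  have hff : f φ = f φ' := congrArg DFunLike.coe h
  refine Subtype.ext (Homeomorph.ext fun p => Subtype.ext ?_)
  rw [hφ, hφ]
  congr 1
  rw [hff]

/-- A homeomorphism is determined by its action on real continuous functions. There are at most `𝔠`
of these, since by Tietze each extends to `StoneCech W`, where it is determined on a countable dense
set. -/
theorem mk_homeomorph_remainder_le [T2Space W] [LocallyCompactSpace W]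
    [TopologicalSpace.SeparableSpace W] :
    #(CechStoneRemainder W ≃ₜ CechStoneRemainder W) ≤ 2 ^ 𝔠 := by
  have hcl := isClosed_cechStoneRemainder (W := W)
  have := compactSpace_cechStoneRemainder (W := W)
  have h1 : #C(StoneCech W, ℝ) ≤ 𝔠 := by
    refine (Cardinal.mk_le_of_injective
      (f := fun A : C(StoneCech W, ℝ) => A.comp ⟨stoneCechUnit, continuous_stoneCechUnit⟩) ?_).trans
      (mk_continuousMap_le_continuum (W := W) (Z := ℝ) Cardinal.mk_real.le)
    intro A A' h
    exact DFunLike.coe_injective (stoneCech_hom_ext A.continuous A'.continuous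
      (congrArg DFunLike.coe h))
  have h2 : #C(CechStoneRemainder W, ℝ) ≤ 𝔠 := by
    refine (Cardinal.mk_le_of_surjective (f := fun A : C(StoneCech W, ℝ) =>
      A.restrict {p : StoneCech W | p ∉ Set.range (stoneCechUnit : W → StoneCech W)})
      fun A => ?_).trans h1
    exact ContinuousMap.exists_restrict_eq hcl A
  have h3 : #(CechStoneRemainder W ≃ₜ CechStoneRemainder W) ≤
      #(C(CechStoneRemainder W, ℝ) → C(CechStoneRemainder W, ℝ)) := by
    refine Cardinal.mk_le_of_injective (f := fun φ A => A.comp ⟨φ, φ.continuous⟩) fun φ φ' h => ?_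
    refine Homeomorph.ext fun p => eq_of_forall_continuous_real fun A => ?_
    exact DFunLike.congr_fun (congrFun h A) p
  refine h3.trans ?_
  rw [← Cardinal.power_def]
  calc #C(CechStoneRemainder W, ℝ) ^ #C(CechStoneRemainder W, ℝ) ≤ 𝔠 ^ (𝔠 : Cardinal) :=
        (Cardinal.power_le_power_right h2).trans
          (Cardinal.power_le_power_left Cardinal.continuum_ne_zero h2)
    _ = 2 ^ 𝔠 := Cardinal.power_self_eq Cardinal.aleph0_le_continuum

theorem BumpFlow.mk_homeomorph_remainder (CH : (ℵ₁ : Cardinal.{0}) = 𝔠) [T2Space W]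
    [LocallyCompactSpace W] (B : BumpFlow W) :
    2 ^ 𝔠 ≤ #{φ : CechStoneRemainder W ≃ₜ CechStoneRemainder W // ¬ IsTrivialHomeo φ} ∧
      (SecondCountableTopology W →
        #(CechStoneRemainder W ≃ₜ CechStoneRemainder W) = 2 ^ 𝔠 ∧
        #{φ : CechStoneRemainder W ≃ₜ CechStoneRemainder W // IsTrivialHomeo φ} ≤ 𝔠 ∧
        #{φ : CechStoneRemainder W ≃ₜ CechStoneRemainder W // ¬ IsTrivialHomeo φ} = 2 ^ 𝔠) := by
  have h := B.continuum_power_le_nontrivial CH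
  have hle := Cardinal.mk_subtype_le
    fun φ : CechStoneRemainder W ≃ₜ CechStoneRemainder W => ¬ IsTrivialHomeo φ
  exact ⟨h, fun _ => ⟨mk_homeomorph_remainder_le.antisymm (h.trans hle), mk_trivialHomeo_le,
    (hle.trans mk_homeomorph_remainder_le).antisymm h⟩⟩

end Counting

/-! ### Discrete families of open sets and compact open sets -/

section DiscreteFamily

variable {X : Type*} [TopologicalSpace X]

theorem IsDiscreteFamily.mono {K U : ℕ → Set X} (hU : IsDiscreteFamily U) (h : ∀ k, K k ⊆ U k) :
    IsDiscreteFamily K := fun x =>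
  (hU x).imp fun _ hk => hk.mono fun _ hy j hj => hy j (h j hj)

/-- A sequence without convergent subsequences has closed discrete range; an unbounded function on
the range extends by Tietze. -/
theorem exists_continuous_unbounded [TopologicalSpace.MetrizableSpace X] [NoncompactSpace X] :
    ∃ u : C(X, ℝ), ∀ R : ℝ, ∃ x, R < u x := by
  classical
  let := TopologicalSpace.metrizableSpaceMetric X
  have hseq : ¬ SeqCompactSpace X := by
    rw [← compactSpace_iff_seqCompactSpace]
    exact not_compactSpace_iff.2 ‹_›
  obtain ⟨x, hx⟩ : ∃ x : ℕ → X, ∀ (l : X) (φ : ℕ → ℕ), StrictMono φ →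
      ¬ Tendsto (x ∘ φ) atTop (𝓝 l) := by
    by_contra! h
    refine hseq ⟨fun x _ => ?_⟩
    obtain ⟨l, φ, hφ, hl⟩ := h x
    exact ⟨l, trivial, φ, hφ, hl⟩
  have hloc : ∀ y, ∃ V ∈ 𝓝 y, ∀ᶠ n in atTop, x n ∉ V := by
    intro y
    by_contra! h
    have : MapClusterPt y atTop x := mapClusterPt_iff_frequently.2 fun V hV => by
      simpa [Filter.Frequently] using h V hV
    obtain ⟨φ, hφ, hl⟩ := this.tendsto_subseq
    exact hx y φ hφ hl
  have hfin : ∀ y, ∃ V ∈ 𝓝 y, (V ∩ Set.range x).Finite := by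
    intro y
    obtain ⟨V, hV, hVx⟩ := hloc y
    obtain ⟨m, hm⟩ := eventually_atTop.1 hVx
    refine ⟨V, hV, ((Finset.range m).image x).finite_toSet.subset ?_⟩
    rintro _ ⟨hz, n, rfl⟩
    rw [Finset.coe_image]
    refine ⟨n, ?_, rfl⟩
    by_contra hn
    exact hm n (by simpa using hn) hz
  set S := Set.range x with hS
  have hScl : IsClosed S := isClosed_range_of_not_tendsto hx
  have hSd : DiscreteTopology S := by
    rw [discreteTopology_subtype_iff]
    intro y hy
    obtain ⟨V, hV, hVS⟩ := hfin y
    have hcl : IsClosed ((V ∩ S) \ {y}) := (hVS.subset Set.sdiff_subset).isClosed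
    rw [← Filter.empty_mem_iff_bot]
    have h1 : ((V ∩ S) \ {y})ᶜ ∈ 𝓝 y := hcl.isOpen_compl.mem_nhds (by simp)
    have h2 : V ∩ ((V ∩ S) \ {y})ᶜ ∩ {y}ᶜ ∈ 𝓝[≠] y :=
      inter_mem (mem_nhdsWithin_of_mem_nhds (inter_mem hV h1)) self_mem_nhdsWithin
    refine mem_of_superset (inter_mem_inf h2 (mem_principal_self S)) ?_
    rintro z ⟨⟨⟨h3, h4⟩, h5⟩, h6⟩
    exact h4 ⟨⟨h3, h6⟩, h5⟩
  let v : S → ℕ := fun s => Nat.find s.2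
  have hv : ∀ s : S, x (v s) = s := fun s => Nat.find_spec s.2
  obtain ⟨u, hu⟩ := ContinuousMap.exists_restrict_eq hScl
    (⟨fun s => (v s : ℝ), continuous_of_discreteTopology⟩ : C(S, ℝ))
  refine ⟨u, fun R => ?_⟩
  by_contra! hR
  obtain ⟨m, hm⟩ := exists_nat_gt R
  have hvm : ∀ s : S, v s < m := fun s => by
    have h1 : u s = v s := DFunLike.congr_fun hu s
    have h2 := hR s
    rw [h1] at h2
    exact_mod_cast h2.trans_lt hm
  have hne : ∀ᶠ n in atTop, ∀ i ∈ Set.Iio m, x n ≠ x i := by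
    rw [eventually_all_finite (Set.finite_Iio m)]
    intro i _
    obtain ⟨V, hV, hVx⟩ := hloc (x i)
    filter_upwards [hVx] with n hn h
    exact hn (h ▸ mem_of_mem_nhds hV)
  obtain ⟨n, hn⟩ := hne.exists
  exact hn (v ⟨x n, n, rfl⟩) (hvm _) (hv ⟨x n, n, rfl⟩).symm

theorem exists_isDiscreteFamily_isOpen [TopologicalSpace.MetrizableSpace X] [NoncompactSpace X] :
    ∃ (x : ℕ → X) (U : ℕ → Set X), IsDiscreteFamily U ∧ ∀ k, IsOpen (U k) ∧ x k ∈ U k := by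
  obtain ⟨u, hu⟩ := exists_continuous_unbounded (X := X)
  choose p hp using hu
  -- The gap `3` is two window radii `1` plus twice the radius `1 / 2` of the neighbourhood tested
  -- below.
  let y : ℕ → X := fun k => Nat.rec (p 0) (fun _ z => p (u z + 3)) k
  have hy : ∀ k, u (y k) + 3 < u (y (k + 1)) := fun k => hp _
  have hmono : StrictMono fun k => u (y k) - 3 * k := strictMono_nat_of_lt_succ fun k => by
    have := hy k
    push_cast
    linarith
  have hgap : ∀ i j, i < j → u (y i) + 3 < u (y j) := by
    intro i j hij
    have h1 := hmono hij
    have h2 : (i : ℝ) + 1 ≤ j := by exact_mod_cast hij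
    simp only at h1
    linarith
  refine ⟨y, fun k => {z | |u z - u (y k)| < 1}, fun x => ?_, fun k => ⟨?_, by simp⟩⟩
  · have key : ∀ a b j k, |u a - u x| < 1 / 2 → |u b - u x| < 1 / 2 → |u a - u (y j)| < 1 →
        |u b - u (y k)| < 1 → j ≤ k := by
      intro a b j k h1 h2 h3 h4
      by_contra! h
      have := hgap k j h
      rw [abs_lt] at h1 h2 h3 h4
      linarith [h1.1, h1.2, h2.1, h2.2, h3.1, h3.2, h4.1, h4.2]
    have hV : ∀ᶠ z in 𝓝 x, |u z - u x| < 1 / 2 := by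
      have : Continuous fun z => |u z - u x| := by fun_prop
      exact (this.tendsto x).eventually (gt_mem_nhds (by simp))
    by_cases h : ∃ k b, |u b - u x| < 1 / 2 ∧ |u b - u (y k)| < 1
    · obtain ⟨k, b, hb, hbk⟩ := h
      refine ⟨k, hV.mono fun z hz j hj => ?_⟩
      exact (key z b j k hz hb hj hbk).antisymm (key b z k j hb hz hbk hj)
    · push Not at h
      exact ⟨0, hV.mono fun z hz j hj => absurd hj (not_lt.2 (h j z hz))⟩
  · have : Continuous fun z => |u z - u (y k)| := by fun_prop
    exact isOpen_Iio.preimage this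

end DiscreteFamily

/-- In a compact neighbourhood `L` of the component, components are intersections of clopen sets, so
some clopen set around `y` lies in `interior L`; it is then open in `Y`. -/
theorem exists_isCompact_isOpen_of_isCompact_connectedComponent {Y : Type*} [TopologicalSpace Y]
    [T2Space Y] [LocallyCompactSpace Y] {y : Y} (hy : IsCompact (connectedComponent y)) :
    ∃ C : Set Y, IsCompact C ∧ IsOpen C ∧ y ∈ C := by
  obtain ⟨L, hL, hyL⟩ := exists_compact_superset hy
  have : CompactSpace L := isCompact_iff_compactSpace.1 hL
  have hyL' : y ∈ L := interior_subset (hyL mem_connectedComponent)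
  let y' : L := ⟨y, hyL'⟩
  have hcomp : connectedComponent y' ⊆ Subtype.val ⁻¹' interior L := by
    intro z hz
    refine hyL ?_
    exact (isPreconnected_connectedComponent.image _ continuous_subtype_val.continuousOn
      |>.subset_connectedComponent ⟨y', mem_connectedComponent, rfl⟩) ⟨z, hz, rfl⟩
  rw [connectedComponent_eq_iInter_isClopen] at hcomp
  have : Nonempty {s : Set L // IsClopen s ∧ y' ∈ s} := ⟨⟨Set.univ, isClopen_univ, trivial⟩⟩
  obtain ⟨⟨Z, hZ, hyZ⟩, hZL⟩ := exists_subset_nhds_of_compactSpace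
    (V := fun s : {s : Set L // IsClopen s ∧ y' ∈ s} => s.1)
    (fun s t => ⟨⟨s.1 ∩ t.1, s.2.1.inter t.2.1, s.2.2, t.2.2⟩, Set.inter_subset_left,
      Set.inter_subset_right⟩) (fun s => s.2.1.isClosed)
    (fun z hz => (isOpen_interior.preimage continuous_subtype_val).mem_nhds (hcomp hz))
  refine ⟨Subtype.val '' Z, hZ.isClosed.isCompact.image continuous_subtype_val, ?_, y', hyZ, rfl⟩
  obtain ⟨O, hO, rfl⟩ := isOpen_induced_iff.1 hZ.isOpen
  have : Subtype.val '' (Subtype.val ⁻¹' O : Set L) = O ∩ interior L := by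
    rw [Subtype.image_preimage_coe]
    refine Set.Subset.antisymm (fun z hz => ?_) fun z hz => ⟨interior_subset hz.2, hz.1⟩
    exact ⟨hz.2, hZL (show (⟨z, hz.1⟩ : L) ∈ _ from hz.2)⟩
  rw [this]
  exact hO.inter isOpen_interior

theorem norm_mem_Icc_of_mem_closedBall {E : Type*} [NormedAddCommGroup E] {v : E}
    (hv : v ∈ Metric.closedBall (0 : E) 1) :
    ‖v‖ ∈ Set.Icc (0 : ℝ) 1 := ⟨norm_nonneg v, mem_closedBall_zero_iff.1 hv⟩

/-! ### Radial flows on balls in charts -/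

section Radial

variable {E : Type*} [NormedAddCommGroup E] [NormedSpace ℝ E]

/-- The flow on the unit ball acting on each radius by the logistic flow. -/
noncomputable def radialFlow (t : ℝ) (v : E) : E :=
  (Real.exp t / (1 - ‖v‖ + Real.exp t * ‖v‖)) • v

theorem norm_radialFlow (t : ℝ) {v : E} (hv : v ∈ Metric.closedBall (0 : E) 1) :
    ‖radialFlow t v‖ = logisticFlow t ‖v‖ := by
  have hD := logisticFlow_denom_pos t (norm_mem_Icc_of_mem_closedBall hv)
  rw [radialFlow, norm_smul, Real.norm_of_nonneg (by positivity), logisticFlow, div_mul_eq_mul_div]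

theorem radialFlow_mem (t : ℝ) {v : E} (hv : v ∈ Metric.closedBall (0 : E) 1) :
    radialFlow t v ∈ Metric.closedBall (0 : E) 1 := by
  rw [mem_closedBall_zero_iff, norm_radialFlow t hv]
  exact (logisticFlow_mem (norm_mem_Icc_of_mem_closedBall hv)).2

theorem radialFlow_zero (v : E) : radialFlow 0 v = v := by simp [radialFlow]

theorem radialFlow_of_norm_eq_one (t : ℝ) {v : E} (hv : ‖v‖ = 1) : radialFlow t v = v := by
  simp [radialFlow, hv, (Real.exp_pos t).ne']

theorem radialFlow_add (s t : ℝ) {v : E} (hv : v ∈ Metric.closedBall (0 : E) 1) :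
    radialFlow (s + t) v = radialFlow s (radialFlow t v) := by
  have hr := norm_mem_Icc_of_mem_closedBall hv
  have hD := logisticFlow_denom_pos t hr
  have hD' := logisticFlow_denom_pos (s + t) hr
  rw [Real.exp_add] at hD'
  rw [radialFlow, radialFlow, norm_radialFlow t hv, radialFlow, smul_smul, Real.exp_add,
    logisticFlow]
  congr 1
  have h : 1 - Real.exp t * ‖v‖ / (1 - ‖v‖ + Real.exp t * ‖v‖) +
      Real.exp s * (Real.exp t * ‖v‖ / (1 - ‖v‖ + Real.exp t * ‖v‖)) =
      (1 - ‖v‖ + Real.exp s * Real.exp t * ‖v‖) / (1 - ‖v‖ + Real.exp t * ‖v‖) := by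
    field_simp; ring
  rw [h]
  field_simp

theorem continuousOn_radialFlow : ContinuousOn (fun p : ℝ × E => radialFlow p.1 p.2)
    (Set.univ ×ˢ Metric.closedBall (0 : E) 1) := by
  unfold radialFlow
  refine ContinuousOn.smul (ContinuousOn.div (by fun_prop) (by fun_prop) ?_) (by fun_prop)
  rintro ⟨t, v⟩ ⟨-, hv⟩
  exact (logisticFlow_denom_pos t (norm_mem_Icc_of_mem_closedBall hv)).ne'

end Radial

open Classical in
theorem continuous_ite_of_isClosed {X Z : Type*} [TopologicalSpace X] [TopologicalSpace Z]
    {K O : Set X} (hK : IsClosed K) (hO : IsOpen O) (hOK : O ⊆ K) {a b : X → Z}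
    (ha : ContinuousOn a K) (hb : Continuous b) (hab : ∀ x ∈ K, x ∉ O → a x = b x) :
    Continuous fun x => if x ∈ K then a x else b x := by
  have hu : K ∪ Oᶜ = Set.univ := by
    refine Set.eq_univ_of_forall fun x => ?_
    by_cases hx : x ∈ O
    · exact Or.inl (hOK hx)
    · exact Or.inr hx
  rw [← continuousOn_univ, ← hu]
  refine ContinuousOn.union_of_isClosed (ha.congr fun x hx => if_pos hx)
    (hb.continuousOn.congr fun x hx => ?_) hK hO.isClosed_compl
  by_cases hxK : x ∈ K
  · simp [hxK, hab x hxK hx]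
  · simp [hxK]

/-- A compact set carrying a flow supported in it and semiconjugate to the logistic flow. -/
structure Bump (W : Type*) [TopologicalSpace W] where
  K : Set W
  isCompact_K : IsCompact K
  F : ℝ → W → W
  continuous_F : Continuous fun p : ℝ × W => F p.1 p.2
  F_zero : ∀ x, F 0 x = x
  F_add : ∀ s t x, F (s + t) x = F s (F t x)
  F_of_notMem : ∀ t, ∀ x ∉ K, F t x = x
  r : W → ℝ
  continuous_r : Continuous r
  r_mem : ∀ x, r x ∈ Set.Icc (0 : ℝ) 1
  r_of_notMem : ∀ x ∉ K, r x = 1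
  r_F : ∀ t x, r (F t x) = logisticFlow t (r x)
  center : W
  center_mem : center ∈ K
  r_center : r center = 1 / 2

-- The radial flow is transported by `j` and extended by the identity. The two definitions agree on
-- the boundary, where `‖q x‖ = 1` and the flow is stationary.
open Classical in
theorem exists_bump_of_embedded_ball {X E : Type*} [TopologicalSpace X] [T2Space X]
    [NormedAddCommGroup E] [NormedSpace ℝ E] [ProperSpace E] [Nontrivial E] {j : E → X} {q : X → E}
    (hj : ContinuousOn j (Metric.closedBall 0 1)) (hqj : ∀ v ∈ Metric.closedBall 0 1, q (j v) = v)
    (hq : ContinuousOn q (j '' Metric.closedBall 0 1)) (hO : IsOpen (j '' Metric.ball 0 1)) :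
    ∃ b : Bump X, b.K = j '' Metric.closedBall 0 1 := by
  set K := j '' Metric.closedBall 0 1 with hKdef
  have hKc : IsCompact K := (isCompact_closedBall 0 1).image_of_continuousOn hj
  have hOK : j '' Metric.ball 0 1 ⊆ K := Set.image_mono Metric.ball_subset_closedBall
  have hqK : ∀ x ∈ K, q x ∈ Metric.closedBall 0 1 ∧ j (q x) = x := by
    rintro _ ⟨v, hv, rfl⟩
    rw [hqj v hv]
    exact ⟨hv, rfl⟩
  have hbd : ∀ x ∈ K, x ∉ j '' Metric.ball 0 1 → ‖q x‖ = 1 := by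
    intro x hx hxO
    refine (mem_closedBall_zero_iff.1 (hqK x hx).1).antisymm (not_lt.1 fun h => hxO ?_)
    exact ⟨q x, mem_ball_zero_iff.2 h, (hqK x hx).2⟩
  let F : ℝ → X → X := fun t x => if x ∈ K then j (radialFlow t (q x)) else x
  let r : X → ℝ := fun x => if x ∈ K then ‖q x‖ else 1
  have hFj : ∀ t, ∀ v ∈ Metric.closedBall 0 1, F t (j v) = j (radialFlow t v) := by
    intro t v hv
    have : j v ∈ K := ⟨v, hv, rfl⟩
    simp only [F, if_pos this, hqj v hv]
  have hrj : ∀ v ∈ Metric.closedBall 0 1, r (j v) = ‖v‖ := by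
    intro v hv
    have : j v ∈ K := ⟨v, hv, rfl⟩
    simp only [r, if_pos this, hqj v hv]
  have hF0 : ∀ t, ∀ x ∉ K, F t x = x := fun t x hx => if_neg hx
  have hr0 : ∀ x ∉ K, r x = 1 := fun x hx => if_neg hx
  have hFc : Continuous fun p : ℝ × X => F p.1 p.2 := by
    have hqc : ContinuousOn (fun p : ℝ × X => (p.1, q p.2)) (Prod.snd ⁻¹' K) :=
      continuous_fst.continuousOn.prodMk (hq.comp continuous_snd.continuousOn fun p hp => hp)
    have hrc : ContinuousOn (fun p : ℝ × X => radialFlow p.1 (q p.2)) (Prod.snd ⁻¹' K) :=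
      continuousOn_radialFlow.comp hqc fun p hp => ⟨trivial, (hqK _ hp).1⟩
    refine continuous_ite_of_isClosed (K := Prod.snd ⁻¹' K)
      (O := Prod.snd ⁻¹' (j '' Metric.ball 0 1)) (hKc.isClosed.preimage continuous_snd)
      (hO.preimage continuous_snd) (Set.preimage_mono hOK)
      (a := fun p => j (radialFlow p.1 (q p.2))) (b := Prod.snd)
      (hj.comp hrc fun p hp => radialFlow_mem _ (hqK _ hp).1) continuous_snd fun p hp hpO => ?_
    rw [radialFlow_of_norm_eq_one _ (hbd _ hp hpO), (hqK _ hp).2]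
  have hrc : Continuous r := continuous_ite_of_isClosed hKc.isClosed hO hOK
    hq.norm continuous_const hbd
  -- A vector of norm `1 / 2` needs `E` nontrivial, that is, positive dimension.
  obtain ⟨v, hv⟩ := exists_norm_eq E (c := 1 / 2) (by norm_num)
  have hvD : v ∈ Metric.closedBall (0 : E) 1 := by
    rw [mem_closedBall_zero_iff, hv]; norm_num
  refine ⟨{
    K := K
    isCompact_K := hKc
    F := F
    continuous_F := hFc
    F_zero := fun x => ?_
    F_add := fun s t x => ?_
    F_of_notMem := hF0
    r := r
    continuous_r := hrc
    r_mem := fun x => ?_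
    r_of_notMem := hr0
    r_F := fun t x => ?_
    center := j v
    center_mem := ⟨v, hvD, rfl⟩
    r_center := by rw [hrj v hvD, hv] }, rfl⟩
  · by_cases hx : x ∈ K
    · obtain ⟨w, hw, rfl⟩ := hx
      rw [hFj 0 w hw, radialFlow_zero]
    · exact hF0 0 x hx
  · by_cases hx : x ∈ K
    · obtain ⟨w, hw, rfl⟩ := hx
      rw [hFj _ w hw, hFj _ w hw, hFj _ _ (radialFlow_mem t hw), radialFlow_add s t hw]
    · rw [hF0 _ x hx, hF0 _ x hx, hF0 _ x hx]
  · by_cases hx : x ∈ K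
    · obtain ⟨w, hw, rfl⟩ := hx
      rw [hrj w hw]
      exact norm_mem_Icc_of_mem_closedBall hw
    · rw [hr0 x hx]; simp
  · by_cases hx : x ∈ K
    · obtain ⟨w, hw, rfl⟩ := hx
      rw [hFj t w hw, hrj _ (radialFlow_mem t hw), hrj w hw, norm_radialFlow t hw]
    · rw [hF0 t x hx, hr0 x hx, logisticFlow_one]

theorem exists_bump_subset {X E : Type*} [TopologicalSpace X] [T2Space X]
    [NormedAddCommGroup E] [NormedSpace ℝ E] [ProperSpace E] [Nontrivial E]
    (e : OpenPartialHomeomorph X E) {x : X} (hx : x ∈ e.source) {U : Set X} (hU : IsOpen U)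
    (hxU : x ∈ U) : ∃ b : Bump X, b.K ⊆ U := by
  have hV : e.target ∩ e.symm ⁻¹' U ∈ 𝓝 (e x) :=
    (e.isOpen_inter_preimage_symm hU).mem_nhds ⟨e.map_source hx, by simpa [e.left_inv hx] using hxU⟩
  obtain ⟨ε, hε, hball⟩ := Metric.nhds_basis_closedBall.mem_iff.1 hV
  set j : E → X := fun v => e.symm (e x + ε • v) with hj
  set q : X → E := fun y => ε⁻¹ • (e y - e x) with hq
  have hmem : ∀ v ∈ Metric.closedBall (0 : E) 1, e x + ε • v ∈ e.target ∩ e.symm ⁻¹' U := by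
    intro v hv
    refine hball ?_
    rw [mem_closedBall_iff_norm, add_sub_cancel_left, norm_smul, Real.norm_of_nonneg hε.le]
    exact mul_le_of_le_one_right hε.le (mem_closedBall_zero_iff.1 hv)
  have hsrc : j '' Metric.closedBall 0 1 ⊆ e.source := by
    rintro _ ⟨v, hv, rfl⟩
    exact e.map_target (hmem v hv).1
  obtain ⟨b, hb⟩ := exists_bump_of_embedded_ball (j := j) (q := q)
    (e.continuousOn_symm.comp (by fun_prop) fun v hv => (hmem v hv).1)
    (fun v hv => by
      simp only [hj, hq]
      rw [e.right_inv (hmem v hv).1, add_sub_cancel_left, inv_smul_smul₀ hε.ne'])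
    (((e.continuousOn.mono hsrc).sub continuousOn_const).const_smul ε⁻¹)
    (by
      have h1 : j '' Metric.ball 0 1 = e.symm '' ((fun v => e x + ε • v) '' Metric.ball 0 1) := by
        rw [Set.image_image]
      rw [h1]
      refine e.symm.isOpen_image_of_subset_source ?_ ?_
      · exact ((Homeomorph.smulOfNeZero ε hε.ne').trans
          (Homeomorph.addLeft (e x))).isOpenMap _ Metric.isOpen_ball
      · rintro _ ⟨v, hv, rfl⟩
        exact (hmem v (Metric.ball_subset_closedBall hv)).1)
  refine ⟨b, ?_⟩
  rw [hb]
  rintro _ ⟨v, hv, rfl⟩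
  exact (hmem v hv).2

/-- A discrete sequence of bumps. -/
def BumpFlow.ofBumps {W : Type*} [TopologicalSpace W] (b : ℕ → Bump W)
    (h : IsDiscreteFamily fun k => (b k).K) : BumpFlow W where
  K k := (b k).K
  isCompact_K k := (b k).isCompact_K
  discrete := h
  F k := (b k).F
  continuous_F k := (b k).continuous_F
  F_zero k := (b k).F_zero
  F_add k := (b k).F_add
  F_of_notMem k := (b k).F_of_notMem
  r k := (b k).r
  continuous_r k := (b k).continuous_r
  r_mem k := (b k).r_mem
  r_of_notMem k := (b k).r_of_notMem
  r_F k := (b k).r_F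
  center k := (b k).center
  center_mem k := (b k).center_mem
  r_center k := (b k).r_center

/-! ### Bump flows on manifolds and products -/

theorem exists_bumpFlow_of_manifold (X E : Type*) [TopologicalSpace X]
    [TopologicalSpace.MetrizableSpace X] [NoncompactSpace X] [NormedAddCommGroup E]
    [NormedSpace ℝ E] [ProperSpace E] [Nontrivial E] [ChartedSpace E X] : Nonempty (BumpFlow X) := by
  obtain ⟨x, U, hU, hxU⟩ := exists_isDiscreteFamily_isOpen (X := X)
  choose b hb using fun k =>
    exists_bump_subset (chartAt E (x k)) (mem_chart_source E (x k)) (hxU k).1 (hxU k).2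
  exact ⟨.ofBumps b (hU.mono hb)⟩

open Classical in
/-- The product of a bump flow with a compact open set. -/
noncomputable def BumpFlow.prod {X Y : Type*} [TopologicalSpace X] [TopologicalSpace Y]
    (B : BumpFlow X) {C : Set Y} (hC : IsCompact C) (hCo : IsClopen C) (y : Y) (hy : y ∈ C) :
    BumpFlow (X × Y) where
  K k := B.K k ×ˢ C
  isCompact_K k := (B.isCompact_K k).prod hC
  discrete z := by
    obtain ⟨k, hk⟩ := B.discrete z.1
    exact ⟨k, (continuous_fst.tendsto z |>.eventually hk).mono fun w hw j hj => hw j hj.1⟩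
  F k t z := if z.2 ∈ C then (B.F k t z.1, z.2) else z
  continuous_F k := by
    have h1 : Continuous fun p : ℝ × X × Y => (B.F k p.1 p.2.1, p.2.2) :=
      ((B.continuous_F k).comp (continuous_fst.prodMk (continuous_fst.comp continuous_snd))).prodMk
        (continuous_snd.comp continuous_snd)
    exact h1.if (fun p hp => by
      have : IsClopen {p : ℝ × X × Y | p.2.2 ∈ C} :=
        hCo.preimage (continuous_snd.comp continuous_snd)
      rw [this.frontier_eq] at hp
      exact hp.elim) continuous_snd
  F_zero k z := by split_ifs <;> simp [B.F_zero]
  F_add k s t z := by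
    by_cases h : z.2 ∈ C
    · simp [h, B.F_add]
    · simp [h]
  F_of_notMem k t z hz := by
    split_ifs with h
    · rw [B.F_of_notMem k t z.1 fun h1 => hz ⟨h1, h⟩]
    · rfl
  r k z := if z.2 ∈ C then B.r k z.1 else 1
  continuous_r k := ((B.continuous_r k).comp continuous_fst).if (fun p hp => by
      have : IsClopen {p : X × Y | p.2 ∈ C} := hCo.preimage continuous_snd
      rw [this.frontier_eq] at hp
      exact hp.elim) continuous_const
  r_mem k z := by
    split_ifs
    · exact B.r_mem k z.1
    · simp
  r_of_notMem k z hz := by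
    split_ifs with h
    · exact B.r_of_notMem k z.1 fun h1 => hz ⟨h1, h⟩
    · rfl
  r_F k t z := by
    by_cases h : z.2 ∈ C
    · simp [h, B.r_F]
    · simp [h, logisticFlow_one]
  center k := (B.center k, y)
  center_mem k := ⟨B.center_mem k, hy⟩
  r_center k := by simp [hy, B.r_center]

end

theorem corollary3p3
    (CH : (ℵ₁ : Cardinal.{0}) = 𝔠)
    (n : ℕ) (hn : 1 ≤ n)
    (X : Type*) [TopologicalSpace X] [TopologicalSpace.MetrizableSpace X] [LocallyCompactSpace X]
    [ChartedSpace (EuclideanSpace ℝ (Fin n)) X] [NoncompactSpace X] :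
    -- the remainder of `X`
    (2 ^ 𝔠 ≤ #{φ : CechStoneRemainder X ≃ₜ CechStoneRemainder X // ¬ IsTrivialHomeo φ} ∧
      (SecondCountableTopology X →
        #(CechStoneRemainder X ≃ₜ CechStoneRemainder X) = 2 ^ 𝔠 ∧
        #{φ : CechStoneRemainder X ≃ₜ CechStoneRemainder X // IsTrivialHomeo φ} ≤ 𝔠 ∧
        #{φ : CechStoneRemainder X ≃ₜ CechStoneRemainder X // ¬ IsTrivialHomeo φ} = 2 ^ 𝔠)) ∧
    -- the remainder of `X × Y`
    (∀ (Y : Type*) [TopologicalSpace Y] [T2Space Y] [LocallyCompactSpace Y],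
      (∃ y : Y, IsCompact (connectedComponent y)) →
      2 ^ 𝔠 ≤ #{φ : CechStoneRemainder (X × Y) ≃ₜ CechStoneRemainder (X × Y) //
          ¬ IsTrivialHomeo φ} ∧
      (SecondCountableTopology X → SecondCountableTopology Y →
        #(CechStoneRemainder (X × Y) ≃ₜ CechStoneRemainder (X × Y)) = 2 ^ 𝔠 ∧
        #{φ : CechStoneRemainder (X × Y) ≃ₜ CechStoneRemainder (X × Y) //
          IsTrivialHomeo φ} ≤ 𝔠 ∧
        #{φ : CechStoneRemainder (X × Y) ≃ₜ CechStoneRemainder (X × Y) //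
          ¬ IsTrivialHomeo φ} = 2 ^ 𝔠)) := by
  have : Nonempty (Fin n) := ⟨⟨0, hn⟩⟩
  obtain ⟨B⟩ := exists_bumpFlow_of_manifold X (EuclideanSpace ℝ (Fin n))
  refine ⟨B.mk_homeomorph_remainder CH, ?_⟩
  intro Y _ _ _ ⟨y, hy⟩
  obtain ⟨C, hC, hCo, hyC⟩ := exists_isCompact_isOpen_of_isCompact_connectedComponent hy
  obtain ⟨h, h'⟩ :=
    (B.prod hC ⟨hC.isClosed, hCo⟩ y hyC).mk_homeomorph_remainder CH
  exact ⟨h, fun _ _ => h' inferInstance⟩
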